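/- Let $K$ be a field of characteristic $0$ and let $X$ be any set. Let $\mathcal{A}s_3$ be the variety of associative $K$-algebras (not necessarily with unit) that satisfy the identity $$abc+bac-bca-cba=0,$$ and let $\mathcal{A}s_3\langle X\rangle$ be the free (non-unital) algebra of this variety on $X$. Let $L=\mathrm{Lie}\langle X\rangle$ be the free Lie algebra over $K$ on $X$, with $L^1=L$ and $L^{k+1}=[L,L^k]$, and let $N=L/L^4$ be the free nilpotent Lie algebra of index $4$ on $X$ (all Lie products of four elements are zero). Then $N$ embeds into $\mathcal{A}s_3\langle X\rangle$ under the commutator: there is an injective $K$-linear map $\varphi\colon N\to\mathcal{A}s_3\langle X\rangle$ such that $\varphi([u,v])=\varphi(u)\varphi(v)-\varphi(v)\varphi(u)$ for all $u,v\in N$, and $\varphi(x)=x$ for every generator $x\in X$. -/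

import Mathlib

universe u v w

/-- The third-type identity `abc + bac - bca - cba = 0`, for a (not necessarily unital)
associative ring `A`. -/
def IsThirdType (A : Type w) [NonUnitalRing A] : Prop :=
  ∀ a b c : A, a * b * c + b * a * c - b * c * a - c * b * a = 0

noncomputable section

/-- The free associative algebra without unit on `X`: its basis is the set of nonempty words. -/
abbrev FreeNonUnitalAssocAlgebra (K : Type u) (X : Type v) [Field K] :=
  MonoidAlgebra K (FreeSemigroup X)

namespace FreeAsThree

variable (K : Type u) (X : Type v) [Field K]

/-- All the values of the third-type polynomial on the free associative algebra without unit
are to be equal to `0`. -/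
inductive Rel : FreeNonUnitalAssocAlgebra K X → FreeNonUnitalAssocAlgebra K X → Prop
  | identity (a b c : FreeNonUnitalAssocAlgebra K X) :
      Rel (a * b * c + b * a * c - b * c * a - c * b * a) 0

/-- The congruence of the T-ideal generated by the third-type identity. -/
def con : RingCon (FreeNonUnitalAssocAlgebra K X) := ringConGen (Rel K X)

end FreeAsThree

/-- The free algebra on `X` in the variety of third-type associative algebras over `K`. -/
def FreeAsThree (K : Type u) (X : Type v) [Field K] : Type (max u v) :=
  (FreeAsThree.con K X).Quotient

namespace FreeAsThree

variable (K : Type u) (X : Type v) [Field K]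

/-- The congruence is stable under multiplication by scalars. -/
theorem con_smul (t : K) {p q : FreeNonUnitalAssocAlgebra K X} (h : con K X p q) :
    con K X (t • p) (t • q) := by
  change RingConGen.Rel (Rel K X) p q at h
  change RingConGen.Rel (Rel K X) (t • p) (t • q)
  induction h with
  | of p q h =>
    obtain ⟨a, b, c⟩ := h
    have := Rel.identity (t • a) b c
    simp only [smul_mul_assoc, mul_smul_comm, ← smul_add, ← smul_sub] at this
    rw [smul_zero]
    exact .of _ _ this
  | refl p => exact .refl _
  | symm _ ih => exact .symm ih
  | trans _ _ ih₁ ih₂ => exact .trans ih₁ ih₂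
  | add _ _ ih₁ ih₂ => rw [smul_add, smul_add]; exact .add ih₁ ih₂
  | mul _ h₂ ih₁ _ => rw [← smul_mul_assoc, ← smul_mul_assoc]; exact .mul ih₁ h₂

instance : NonUnitalRing (FreeAsThree K X) :=
  inferInstanceAs (NonUnitalRing (con K X).Quotient)

/-- The quotient map. -/
def mk : FreeNonUnitalAssocAlgebra K X →+ FreeAsThree K X where
  toFun p := ((p : (con K X).Quotient) : FreeAsThree K X)
  map_zero' := rfl
  map_add' _ _ := rfl

theorem mk_surjective : Function.Surjective (mk K X) :=
  Quotient.mk''_surjective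

theorem mk_mul (p q : FreeNonUnitalAssocAlgebra K X) :
    mk K X (p * q) = mk K X p * mk K X q := rfl

instance : SMul K (FreeAsThree K X) where
  smul t := Quotient.map' (s₁ := (con K X).toSetoid) (s₂ := (con K X).toSetoid) (t • ·)
    fun _ _ h => con_smul K X t h

theorem mk_smul (t : K) (p : FreeNonUnitalAssocAlgebra K X) :
    mk K X (t • p) = t • mk K X p := rfl

instance : Module K (FreeAsThree K X) :=
  Function.Surjective.module K (mk K X) (mk_surjective K X) (mk_smul K X)

instance : IsScalarTower K (FreeAsThree K X) (FreeAsThree K X) where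
  smul_assoc t a b := by
    obtain ⟨p, rfl⟩ := mk_surjective K X a
    obtain ⟨q, rfl⟩ := mk_surjective K X b
    simp only [smul_eq_mul, ← mk_smul, ← mk_mul, smul_mul_assoc]

instance : SMulCommClass K (FreeAsThree K X) (FreeAsThree K X) where
  smul_comm t a b := by
    obtain ⟨p, rfl⟩ := mk_surjective K X a
    obtain ⟨q, rfl⟩ := mk_surjective K X b
    simp only [smul_eq_mul, ← mk_smul, ← mk_mul, mul_smul_comm]

variable {X}

/-- The free generator of the free third-type algebra that corresponds to `x`. -/
def of (x : X) : FreeAsThree K X := mk K X (MonoidAlgebra.single (FreeSemigroup.of x) 1)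

variable (X)

/-- The free third-type algebra belongs to the variety. -/
theorem isThirdType : IsThirdType (FreeAsThree K X) := by
  intro a b c
  obtain ⟨p, rfl⟩ := mk_surjective K X a
  obtain ⟨q, rfl⟩ := mk_surjective K X b
  obtain ⟨r, rfl⟩ := mk_surjective K X c
  simp only [← mk_mul, ← map_add, ← map_sub]
  exact Quotient.sound' (RingConGen.Rel.of _ _ (Rel.identity p q r))

/-- The universal property: a map from `X` to a third-type associative algebra extends uniquely
to a homomorphism of algebras. -/
theorem existsUnique_lift {A : Type w} [NonUnitalRing A] [Module K A] [IsScalarTower K A A]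
    [SMulCommClass K A A] (hA : IsThirdType A) (f : X → A) :
    ∃! F : FreeAsThree K X →ₙₐ[K] A, ∀ x, F (of K x) = f x := by
  let G : FreeNonUnitalAssocAlgebra K X →ₙₐ[K] A :=
    MonoidAlgebra.liftMagma K (FreeSemigroup.lift f)
  have hG : ∀ p q, con K X p q → G p = G q := by
    intro p q h
    change RingConGen.Rel (Rel K X) p q at h
    induction h with
    | of p q h =>
      obtain ⟨a, b, c⟩ := h
      simpa only [map_sub, map_add, map_mul, map_zero] using hA (G a) (G b) (G c)
    | refl p => rfl
    | symm _ ih => exact ih.symm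
    | trans _ _ ih₁ ih₂ => exact ih₁.trans ih₂
    | add _ _ ih₁ ih₂ => rw [map_add, map_add, ih₁, ih₂]
    | mul _ _ ih₁ ih₂ => rw [map_mul, map_mul, ih₁, ih₂]
  let F : FreeAsThree K X →ₙₐ[K] A :=
    { toFun := fun a => Quotient.liftOn' (s₁ := (con K X).toSetoid) a G hG
      map_smul' := by rintro t ⟨a⟩; exact map_smul G t a
      map_zero' := map_zero G
      map_add' := by rintro ⟨a⟩ ⟨b⟩; exact map_add G a b
      map_mul' := by rintro ⟨a⟩ ⟨b⟩; exact map_mul G a b }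
  refine ⟨F, fun x => ?_, fun F' hF' => ?_⟩
  · change G (MonoidAlgebra.single (FreeSemigroup.of x) 1) = f x
    simp [G]
  · let π : FreeNonUnitalAssocAlgebra K X →ₙₐ[K] FreeAsThree K X :=
      { toFun := mk K X
        map_smul' := mk_smul K X
        map_zero' := map_zero _
        map_add' := map_add _
        map_mul' := mk_mul K X }
    have key : F'.comp π = G := by
      refine (MonoidAlgebra.liftMagma K).symm.injective ?_
      refine FreeSemigroup.hom_ext (funext fun x => ?_)
      change F' (of K x) = G (MonoidAlgebra.single (FreeSemigroup.of x) 1)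
      rw [hF']
      simp [G]
    ext a
    obtain ⟨p, rfl⟩ := mk_surjective K X a
    exact DFunLike.congr_fun key p

end FreeAsThree

/-- The free nilpotent Lie algebra of class `n`, that is, of index `n + 1`, on `X`: the quotient
`L / L ^ (n + 1)` of the free Lie algebra `L`, where `L ^ 1 = L` and `L ^ (k + 1) = [L, L ^ k]`.
In Mathlib `L ^ (n + 1)` is `LieModule.lowerCentralSeries K L L n`. -/
abbrev FreeNilpotentLieAlgebra (K : Type u) (X : Type v) [Field K] (n : ℕ) :=
  FreeLieAlgebra K X ⧸ LieModule.lowerCentralSeries K (FreeLieAlgebra K X) (FreeLieAlgebra K X) n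

/-- The free generator of the free nilpotent Lie algebra that corresponds to `x`. -/
def FreeNilpotentLieAlgebra.of (K : Type u) {X : Type v} [Field K] (n : ℕ) (x : X) :
    FreeNilpotentLieAlgebra K X n :=
  LieSubmodule.Quotient.mk (FreeLieAlgebra.of K x)

end

noncomputable section

/-! The third-type identity forces threefold commutators to vanish, so the homomorphism from the
free Lie algebra that fixes the generators factors through `N`. Injectivity rests on the
Dynkin–Specht–Wever idea: sending a word of length `n` to `1/n` times its left-normed bracket
restores Lie elements. In length three the identity costs nothing, since `abc + bac` and `bca + cba`
both die by antisymmetry of the inner bracket. `ThirdTypeModel` is an algebra of the variety through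
which this map factors, `toLie` is the map itself, and on Lie-like elements it respects brackets
(`IsLieLike.toLie_lie`). Composed with the map from the free third-type algebra to the model, it is
a left inverse of the embedding. -/

/-- The commutator Lie ring of an associative ring without unit. -/
@[reducible]
def LieRing.ofNonUnitalRing (A : Type w) [NonUnitalRing A] : LieRing A where
  add_lie _ _ _ := by simp only [Ring.lie_def, right_distrib, left_distrib]; abel
  lie_add _ _ _ := by simp only [Ring.lie_def, right_distrib, left_distrib]; abel
  lie_self := by simp only [Ring.lie_def, forall_const, sub_self]
  leibniz_lie _ _ _ := by
    simp only [Ring.lie_def, mul_sub, sub_mul, mul_assoc]; abel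

attribute [local instance 100] LieRing.ofNonUnitalRing

/-- The commutator Lie algebra of an associative algebra without unit. -/
@[reducible]
def LieAlgebra.ofNonUnitalAlgebra (K : Type u) (A : Type w) [CommRing K] [NonUnitalRing A]
    [Module K A] [IsScalarTower K A A] [SMulCommClass K A A] : LieAlgebra K A where
  lie_smul t x y := by
    rw [Ring.lie_def, Ring.lie_def, mul_smul_comm, smul_mul_assoc, smul_sub]

attribute [local instance 100] LieAlgebra.ofNonUnitalAlgebra

/-! ### Nilpotency of the commutator Lie ring -/

/-- The commutator Lie ring of an algebra of the third type is nilpotent of class `3`. -/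
theorem IsThirdType.lie_lie_lie_eq_zero (K : Type u) {A : Type w} [Field K] [CharZero K]
    [NonUnitalRing A] [Module K A] (hA : IsThirdType A) (a b c d : A) :
    ⁅d, ⁅c, ⁅a, b⁆⁆⁆ = 0 := by
  -- Each bracketed term is the identity with a product of two letters substituted for one variable;
  -- expanding into words verifies the combination. Characteristic zero then removes the factor 2.
  have key : (2 : K) • ⁅d, ⁅c, ⁅a, b⁆⁆⁆ =
      (d * c * a * b + a * (d * c) * b - a * b * (d * c) - b * a * (d * c))
      - (d * c * b * a + b * (d * c) * a - b * a * (d * c) - a * b * (d * c))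
      - (b * c * (a * d) + c * b * (a * d) - c * (a * d) * b - a * d * c * b)
      - (c * b * d * a + d * (c * b) * a - d * a * (c * b) - a * d * (c * b))
      - (3 : K) • (d * a * (c * b) + a * d * (c * b) - a * (c * b) * d - c * b * a * d)
      - (2 : K) • (b * (a * c) * d + a * c * b * d - a * c * d * b - d * (a * c) * b)
      - (2 : K) • (d * a * (b * c) + a * d * (b * c) - a * (b * c) * d - b * c * a * d)
      + (d * (c * a) * b + c * a * d * b - c * a * b * d - b * (c * a) * d)
      + (b * d * c * a + c * (b * d) * a - c * a * (b * d) - a * c * (b * d))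
      + (2 : K) • (d * b * a * c + a * (d * b) * c - a * c * (d * b) - c * a * (d * b)) := by
    simp only [Ring.lie_def, mul_sub, sub_mul, mul_assoc]
    module
  rw [hA (d * c) a b, hA (d * c) b a, hA b c (a * d), hA (c * b) d a, hA d a (c * b),
    hA b (a * c) d, hA d a (b * c), hA d (c * a) b, hA (b * d) c a, hA (d * b) a c] at key
  simp only [smul_zero, sub_zero, add_zero] at key
  exact (smul_eq_zero.mp key).resolve_left two_ne_zero

/-! ### The model algebra -/

/-- A third-type associative algebra built from a Lie algebra `N`: the components of an element
are its part of degree one, the values `⁅v, w⁆` and `u ↦ ⁅⁅u, v⁆, w⁆` of its part `v ⊗ w` of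
degree two, and its part of degree three. -/
@[ext]
structure ThirdTypeModel (K : Type u) (N : Type w) [Field K] [LieRing N] [LieAlgebra K N] where
  /-- The part of degree one. -/
  fst : N
  /-- The bracket of the part of degree two. -/
  brk : N
  /-- The action of the part of degree two from the right. -/
  act : N →ₗ[K] N
  /-- The part of degree three. -/
  trd : N

namespace ThirdTypeModel

variable {K : Type u} {N : Type w} [Field K] [LieRing N] [LieAlgebra K N]

/-- The underlying tuple. -/
def toProd (a : ThirdTypeModel K N) : N × N × (N →ₗ[K] N) × N := (a.fst, a.brk, a.act, a.trd)

theorem toProd_injective : Function.Injective (toProd : ThirdTypeModel K N → _) := by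
  rintro ⟨⟩ ⟨⟩ h
  simpa [toProd] using h

instance : Zero (ThirdTypeModel K N) := ⟨⟨0, 0, 0, 0⟩⟩
instance : Add (ThirdTypeModel K N) :=
  ⟨fun a b => ⟨a.fst + b.fst, a.brk + b.brk, a.act + b.act, a.trd + b.trd⟩⟩
instance : Neg (ThirdTypeModel K N) := ⟨fun a => ⟨-a.fst, -a.brk, -a.act, -a.trd⟩⟩
instance : Sub (ThirdTypeModel K N) :=
  ⟨fun a b => ⟨a.fst - b.fst, a.brk - b.brk, a.act - b.act, a.trd - b.trd⟩⟩
instance {S : Type*} [Monoid S] [DistribMulAction S N] [SMulCommClass K S N] :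
    SMul S (ThirdTypeModel K N) :=
  ⟨fun t a => ⟨t • a.fst, t • a.brk, t • a.act, t • a.trd⟩⟩

instance : AddCommGroup (ThirdTypeModel K N) :=
  toProd_injective.addCommGroup _ rfl (fun _ _ => rfl) (fun _ => rfl) (fun _ _ => rfl)
    (fun _ _ => rfl) (fun _ _ => rfl)

/-- The underlying tuple, as an additive homomorphism. -/
def toProdHom : ThirdTypeModel K N →+ N × N × (N →ₗ[K] N) × N where
  toFun := toProd
  map_zero' := rfl
  map_add' _ _ := rfl

instance : Module K (ThirdTypeModel K N) :=
  toProd_injective.module K toProdHom fun _ _ => rfl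

/-- The Dynkin weight `1/3` is built into degree three: `brk` serves products `(vw)u` and `act`
serves `u(vw)`. -/
instance : Mul (ThirdTypeModel K N) :=
  ⟨fun a b => ⟨0, ⁅a.fst, b.fst⁆,
    LieAlgebra.ad K N b.fst ∘ₗ LieAlgebra.ad K N a.fst,
    (3 : K)⁻¹ • (⁅a.brk, b.fst⁆ + b.act a.fst)⟩⟩

@[simp] theorem fst_zero : (0 : ThirdTypeModel K N).fst = 0 := rfl
@[simp] theorem brk_zero : (0 : ThirdTypeModel K N).brk = 0 := rfl
@[simp] theorem act_zero : (0 : ThirdTypeModel K N).act = 0 := rfl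
@[simp] theorem trd_zero : (0 : ThirdTypeModel K N).trd = 0 := rfl

section

variable (a b : ThirdTypeModel K N)

@[simp] theorem fst_add : (a + b).fst = a.fst + b.fst := rfl
@[simp] theorem brk_add : (a + b).brk = a.brk + b.brk := rfl
@[simp] theorem act_add : (a + b).act = a.act + b.act := rfl
@[simp] theorem trd_add : (a + b).trd = a.trd + b.trd := rfl
@[simp] theorem fst_sub : (a - b).fst = a.fst - b.fst := rfl
@[simp] theorem brk_sub : (a - b).brk = a.brk - b.brk := rfl
@[simp] theorem act_sub : (a - b).act = a.act - b.act := rfl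
@[simp] theorem trd_sub : (a - b).trd = a.trd - b.trd := rfl
@[simp] theorem fst_smul (t : K) : (t • a).fst = t • a.fst := rfl
@[simp] theorem brk_smul (t : K) : (t • a).brk = t • a.brk := rfl
@[simp] theorem act_smul (t : K) : (t • a).act = t • a.act := rfl
@[simp] theorem trd_smul (t : K) : (t • a).trd = t • a.trd := rfl
@[simp] theorem fst_mul : (a * b).fst = 0 := rfl
@[simp] theorem brk_mul : (a * b).brk = ⁅a.fst, b.fst⁆ := rfl
@[simp] theorem act_mul (u : N) : (a * b).act u = ⁅⁅u, a.fst⁆, b.fst⁆ := by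
  change ⁅b.fst, ⁅a.fst, u⁆⁆ = _
  rw [← lie_skew u, neg_lie, lie_skew]
@[simp] theorem trd_mul : (a * b).trd = (3 : K)⁻¹ • (⁅a.brk, b.fst⁆ + b.act a.fst) := rfl

end

instance : NonUnitalRing (ThirdTypeModel K N) where
  left_distrib a b c := by
    ext <;> simp
    module
  right_distrib a b c := by
    ext <;> simp
    module
  zero_mul a := by ext <;> simp
  mul_zero a := by ext <;> simp
  -- Both sides have only a degree-three part, a third of the left-normed bracket of the three `fst`
  -- components.
  mul_assoc a b c := by ext <;> simp

instance : IsScalarTower K (ThirdTypeModel K N) (ThirdTypeModel K N) where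
  smul_assoc t a b := by
    ext <;> simp
    module

instance : SMulCommClass K (ThirdTypeModel K N) (ThirdTypeModel K N) where
  smul_comm t a b := by
    ext <;> simp
    module

/-- Left-normed brackets change sign when the first two entries are swapped, so the four terms
cancel in pairs. -/
theorem isThirdType : IsThirdType (ThirdTypeModel K N) := by
  intro a b c
  ext
  · simp
  · simp
  · simp
  · have h₁ : ⁅⁅b.fst, a.fst⁆, c.fst⁆ = -⁅⁅a.fst, b.fst⁆, c.fst⁆ := by rw [← neg_lie, lie_skew]
    have h₂ : ⁅⁅c.fst, b.fst⁆, a.fst⁆ = -⁅⁅b.fst, c.fst⁆, a.fst⁆ := by rw [← neg_lie, lie_skew]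
    simp only [trd_sub, trd_add, trd_mul, brk_mul, fst_mul, map_zero,
      add_zero, h₁, h₂, trd_zero]
    module

variable (K) in
/-- The canonical image of an element of the Lie algebra. -/
def ι (x : N) : ThirdTypeModel K N := ⟨x, 0, 0, 0⟩

variable (K N) in
/-- A linear retraction of the model onto the Lie algebra. -/
def toLie : ThirdTypeModel K N →ₗ[K] N where
  -- Dynkin weights 1, 1/2, 1/3; the last is already inside `trd`.
  toFun a := a.fst + (2 : K)⁻¹ • a.brk + a.trd
  map_add' a b := by simp only [fst_add, brk_add, trd_add]; module
  map_smul' t a := by simp only [fst_smul, brk_smul, trd_smul, RingHom.id_apply]; module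

theorem toLie_apply (a : ThirdTypeModel K N) :
    toLie K N a = a.fst + (2 : K)⁻¹ • a.brk + a.trd := rfl

/-! ### Lie-like elements -/

/-- The conditions that single out, in the model of a nilpotent Lie algebra of class `3`, a Lie
subalgebra on which `toLie` is a homomorphism. -/
structure IsLieLike (a : ThirdTypeModel K N) : Prop where
  lie_lie_brk : ∀ v w : N, ⁅v, ⁅w, a.brk⁆⁆ = 0
  -- Quantifying over all such `q` keeps the condition linear in `a`, yet makes the `brk` parts of
  -- two Lie-like elements commute.
  lie_brk : ∀ q : N, (∀ v w : N, ⁅v, ⁅w, q⁆⁆ = 0) → ⁅q, a.brk⁆ = 0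
  act_eq : ∀ u : N, a.act u = (2 : K)⁻¹ • ⁅u, a.brk⁆
  lie_trd : ∀ v : N, ⁅v, a.trd⁆ = 0

theorem isLieLike_ι (x : N) : IsLieLike (ι K x) where
  lie_lie_brk v w := by simp [ι]
  lie_brk q _ := by simp [ι]
  act_eq u := by simp [ι]
  lie_trd v := by simp [ι]

theorem brk_lie (a b : ThirdTypeModel K N) : ⁅a, b⁆.brk = (2 : K) • ⁅a.fst, b.fst⁆ := by
  rw [Ring.lie_def, brk_sub, brk_mul, brk_mul, ← lie_skew a.fst b.fst]
  module

variable [CharZero K]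

/-- Each bracket arises once from `brk` and with weight `1/2` from `act`, and `1/3 * (1 + 1/2) =
1/2`. -/
theorem IsLieLike.trd_lie {a b : ThirdTypeModel K N} (ha : IsLieLike a) (hb : IsLieLike b) :
    ⁅a, b⁆.trd = (2 : K)⁻¹ • (⁅a.brk, b.fst⁆ + ⁅a.fst, b.brk⁆) := by
  rw [Ring.lie_def, trd_sub, trd_mul, trd_mul, ha.act_eq, hb.act_eq, ← lie_skew b.fst a.brk,
    ← lie_skew b.brk a.fst]
  match_scalars <;> norm_num

theorem IsLieLike.lie (hN : ∀ u v w x : N, ⁅u, ⁅v, ⁅w, x⁆⁆⁆ = 0) {a b : ThirdTypeModel K N}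
    (ha : IsLieLike a) (hb : IsLieLike b) : IsLieLike ⁅a, b⁆ where
  lie_lie_brk v w := by rw [brk_lie, lie_smul, lie_smul, hN, smul_zero]
  lie_brk q hq := by
    have h (v w : N) : ⁅⁅q, v⁆, w⁆ = 0 := by rw [← lie_skew, ← lie_skew q v, lie_neg, hq]; simp
    rw [brk_lie, lie_smul, leibniz_lie, h, ← lie_skew a.fst, h]
    simp
  act_eq u := by
    -- This is the Jacobi identity `[[u,v],w] - [[u,w],v] = [u,[v,w]]`.
    rw [brk_lie, lie_smul, leibniz_lie, Ring.lie_def, act_sub, LinearMap.sub_apply, act_mul,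
      act_mul, ← lie_skew a.fst ⁅u, b.fst⁆]
    match_scalars <;> norm_num
  lie_trd v := by
    rw [ha.trd_lie hb, lie_smul, lie_add, hb.lie_lie_brk, ← lie_skew a.brk, lie_neg,
      ha.lie_lie_brk]
    simp

theorem IsLieLike.toLie_lie {a b : ThirdTypeModel K N} (ha : IsLieLike a) (hb : IsLieLike b) :
    toLie K N ⁅a, b⁆ = ⁅toLie K N a, toLie K N b⁆ := by
  have h (x : N) : ⁅a.trd, x⁆ = 0 := by rw [← lie_skew, ha.lie_trd, neg_zero]
  simp only [toLie_apply, brk_lie, ha.trd_lie hb, lie_add, add_lie, lie_smul, smul_lie, h,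
    hb.lie_trd, hb.lie_brk _ ha.lie_lie_brk]
  rw [Ring.lie_def, fst_sub, fst_mul, fst_mul]
  match_scalars <;> norm_num

variable (K) in
/-- The Lie subalgebra of Lie-like elements. -/
def lieLike (hN : ∀ u v w x : N, ⁅u, ⁅v, ⁅w, x⁆⁆⁆ = 0) :
    LieSubalgebra K (ThirdTypeModel K N) where
  carrier := {a | IsLieLike a}
  add_mem' {a b} ha hb :=
    { lie_lie_brk v w := by simp [ha.lie_lie_brk, hb.lie_lie_brk]
      lie_brk q hq := by simp [ha.lie_brk q hq, hb.lie_brk q hq]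
      act_eq u := by simp [ha.act_eq, hb.act_eq]
      lie_trd v := by simp [ha.lie_trd, hb.lie_trd] }
  zero_mem' := ⟨by simp, by simp, by simp, by simp⟩
  smul_mem' t a ha :=
    { lie_lie_brk v w := by simp [ha.lie_lie_brk]
      lie_brk q hq := by simp [ha.lie_brk q hq]
      act_eq u := by simp [ha.act_eq, smul_comm t]
      lie_trd v := by simp [ha.lie_trd] }
  lie_mem' ha hb := ha.lie hN hb

/-- The retraction onto the Lie algebra is a homomorphism on Lie-like elements. -/
def lieLikeToLie (hN : ∀ u v w x : N, ⁅u, ⁅v, ⁅w, x⁆⁆⁆ = 0) : lieLike K hN →ₗ⁅K⁆ N where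
  toLinearMap := toLie K N ∘ₗ (lieLike K hN).toSubmodule.subtype
  map_lie' {a b} := IsLieLike.toLie_lie a.2 b.2

end ThirdTypeModel

/-- A homomorphism of associative algebras, as a homomorphism of their commutator Lie algebras. -/
def NonUnitalAlgHom.toCommutatorLieHom {K : Type u} {A : Type v} {B : Type w} [Field K]
    [NonUnitalRing A] [Module K A] [IsScalarTower K A A] [SMulCommClass K A A]
    [NonUnitalRing B] [Module K B] [IsScalarTower K B B] [SMulCommClass K B B]
    (F : A →ₙₐ[K] B) : A →ₗ⁅K⁆ B where
  toFun := F
  map_add' := map_add F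
  map_smul' := map_smul F
  map_lie' {a b} := by simp only [Ring.lie_def, map_sub, map_mul]

/-! ### The free nilpotent Lie algebra and the embedding -/

namespace FreeNilpotentLieAlgebra

variable (K : Type u) (X : Type v) [Field K]

/-- The projection from the free Lie algebra. -/
def proj (n : ℕ) : FreeLieAlgebra K X →ₗ⁅K⁆ FreeNilpotentLieAlgebra K X n where
  toFun := LieSubmodule.Quotient.mk
  map_add' _ _ := rfl
  map_smul' _ _ := rfl
  map_lie' := rfl

theorem proj_surjective (n : ℕ) : Function.Surjective (proj K X n) :=
  Quotient.mk''_surjective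

theorem lie_lie_lie_eq_zero (a b c d : FreeNilpotentLieAlgebra K X 3) :
    ⁅a, ⁅b, ⁅c, d⁆⁆⁆ = 0 := by
  obtain ⟨a, rfl⟩ := proj_surjective K X 3 a
  obtain ⟨b, rfl⟩ := proj_surjective K X 3 b
  obtain ⟨c, rfl⟩ := proj_surjective K X 3 c
  obtain ⟨d, rfl⟩ := proj_surjective K X 3 d
  simp only [← LieHom.map_lie]
  refine LieSubmodule.Quotient.mk_eq_zero'.mpr ?_
  simp only [LieModule.lowerCentralSeries_succ, LieModule.lowerCentralSeries_zero]
  exact LieSubmodule.lie_mem_lie trivial (LieSubmodule.lie_mem_lie trivial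
    (LieSubmodule.lie_mem_lie trivial trivial))

end FreeNilpotentLieAlgebra

/-- A homomorphism into a Lie algebra that is nilpotent of class `3` vanishes on the fourth term
of the lower central series. -/
theorem LieHom.eq_zero_of_mem_lowerCentralSeries {K : Type u} {L : Type v} {M : Type w} [Field K]
    [LieRing L] [LieAlgebra K L] [LieRing M] [LieAlgebra K M]
    (hM : ∀ a b c d : M, ⁅a, ⁅b, ⁅c, d⁆⁆⁆ = 0) (f : L →ₗ⁅K⁆ M) {x : L}
    (hx : x ∈ LieModule.lowerCentralSeries K L L 3) : f x = 0 := by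
  -- Terms of the series are spanned by brackets, so each further term needs one bracket fewer to
  -- vanish.
  have h₁ : ∀ x ∈ LieModule.lowerCentralSeries K L L 1, ∀ a b : M, ⁅a, ⁅b, f x⁆⁆ = 0 := by
    intro x hx a b
    rw [LieModule.lowerCentralSeries_succ, ← LieSubmodule.mem_toSubmodule,
      LieSubmodule.lieIdeal_oper_eq_linear_span'] at hx
    induction hx using Submodule.span_induction with
    | mem x h => obtain ⟨y, -, z, -, rfl⟩ := h; rw [LieHom.map_lie, hM]
    | zero => simp
    | add x y _ _ hx hy => simp [hx, hy]
    | smul t x _ hx => simp [hx]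
  have h₂ : ∀ x ∈ LieModule.lowerCentralSeries K L L 2, ∀ a : M, ⁅a, f x⁆ = 0 := by
    intro x hx a
    rw [LieModule.lowerCentralSeries_succ, ← LieSubmodule.mem_toSubmodule,
      LieSubmodule.lieIdeal_oper_eq_linear_span'] at hx
    induction hx using Submodule.span_induction with
    | mem x h => obtain ⟨y, -, z, hz, rfl⟩ := h; rw [LieHom.map_lie, h₁ z hz]
    | zero => simp
    | add x y _ _ hx hy => simp [hx, hy]
    | smul t x _ hx => simp [hx]
  rw [LieModule.lowerCentralSeries_succ, ← LieSubmodule.mem_toSubmodule,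
    LieSubmodule.lieIdeal_oper_eq_linear_span'] at hx
  induction hx using Submodule.span_induction with
  | mem x h => obtain ⟨y, -, z, hz, rfl⟩ := h; rw [LieHom.map_lie, h₂ z hz]
  | zero => simp
  | add x y _ _ hx hy => simp [hx, hy]
  | smul t x _ hx => simp [hx]

/-- The free nilpotent Lie algebra of class `3` embeds into the free third-type algebra. -/
theorem FreeNilpotentLieAlgebra.exists_embedding (K : Type u) [Field K] [CharZero K]
    (X : Type v) :
    ∃ φ : FreeNilpotentLieAlgebra K X 3 →ₗ[K] FreeAsThree K X,
      Function.Injective φ ∧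
      (∀ u v : FreeNilpotentLieAlgebra K X 3, φ ⁅u, v⁆ = φ u * φ v - φ v * φ u) ∧
      ∀ x : X, φ (FreeNilpotentLieAlgebra.of K 3 x) = FreeAsThree.of K x := by
  let L := FreeLieAlgebra K X
  let N := FreeNilpotentLieAlgebra K X 3
  let π : L →ₗ⁅K⁆ N := FreeNilpotentLieAlgebra.proj K X 3
  let f : L →ₗ⁅K⁆ FreeAsThree K X := FreeLieAlgebra.lift K (FreeAsThree.of K)
  have hnil (a b c d : FreeAsThree K X) : ⁅a, ⁅b, ⁅c, d⁆⁆⁆ = 0 :=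
    (FreeAsThree.isThirdType K X).lie_lie_lie_eq_zero K c d b a
  let φ : N →ₗ[K] FreeAsThree K X :=
    (LieModule.lowerCentralSeries K L L 3).toSubmodule.liftQ f.toLinearMap
      fun _ hx => f.eq_zero_of_mem_lowerCentralSeries hnil hx
  have hφ (a : L) : φ (π a) = f a := rfl
  have hN := FreeNilpotentLieAlgebra.lie_lie_lie_eq_zero K X
  obtain ⟨F, hF, -⟩ := FreeAsThree.existsUnique_lift K X
    (ThirdTypeModel.isThirdType (K := K) (N := N)) fun x => ThirdTypeModel.ι K (π (.of K x))
  let θ : L →ₗ⁅K⁆ ThirdTypeModel.lieLike K hN := FreeLieAlgebra.lift K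
    fun x => ⟨ThirdTypeModel.ι K (π (.of K x)), ThirdTypeModel.isLieLike_ι _⟩
  -- Agreement on generators shows that `F` maps the image of `f` into the Lie-like elements.
  have hθ : (ThirdTypeModel.lieLike K hN).incl.comp θ = F.toCommutatorLieHom.comp f := by
    refine FreeLieAlgebra.hom_ext fun x => ?_
    change (θ (.of K x) : ThirdTypeModel K N) = F (f (.of K x))
    rw [FreeLieAlgebra.lift_of_apply, FreeLieAlgebra.lift_of_apply, hF]
  have hπ : (ThirdTypeModel.lieLikeToLie hN).comp θ = π := by
    refine FreeLieAlgebra.hom_ext fun x => ?_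
    change ThirdTypeModel.toLie K N (θ (.of K x) : ThirdTypeModel K N) = _
    rw [FreeLieAlgebra.lift_of_apply]
    simp [ThirdTypeModel.toLie_apply, ThirdTypeModel.ι]
  refine ⟨φ, ?_, ?_, fun x => ?_⟩
  · refine Function.LeftInverse.injective (g := fun a => ThirdTypeModel.toLie K N (F a)) ?_
    intro u
    obtain ⟨a, rfl⟩ := FreeNilpotentLieAlgebra.proj_surjective K X 3 u
    change ThirdTypeModel.toLie K N (F (f a)) = π a
    exact (congrArg (ThirdTypeModel.toLie K N) (LieHom.congr_fun hθ a)).symm.trans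
      (LieHom.congr_fun hπ a)
  · intro u v
    obtain ⟨a, rfl⟩ := FreeNilpotentLieAlgebra.proj_surjective K X 3 u
    obtain ⟨b, rfl⟩ := FreeNilpotentLieAlgebra.proj_surjective K X 3 v
    exact LieHom.map_lie f a b
  · exact FreeLieAlgebra.lift_of_apply (FreeAsThree.of K) x

end

theorem mainTheorem4 (K : Type*) [Field K] [CharZero K] (X : Type*) :
    ∃ φ : FreeNilpotentLieAlgebra K X 3 →ₗ[K] FreeAsThree K X,
      Function.Injective φ ∧
      (∀ u v : FreeNilpotentLieAlgebra K X 3, φ ⁅u, v⁆ = φ u * φ v - φ v * φ u) ∧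
      ∀ x : X, φ (FreeNilpotentLieAlgebra.of K 3 x) = FreeAsThree.of K x :=
  FreeNilpotentLieAlgebra.exists_embedding K X
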